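/- Let $\lambda$ be Lebesgue measure on $\mathbb R$, let $\mathfrak c$ be the cardinality of $\mathbb R$, regarded as an initial ordinal, and let $$\mathrm{non}(\mathcal N)=\min\{\mathrm{card}(X): X\subseteq[0,1],\ X \text{ is not a Lebesgue null set}\}.$$ Let $(\mathbb R^{\mathbb R})^{\mathfrak c}$ be the commutative real algebra of $\mathfrak c$-sequences $(f_\alpha)_{\alpha<\mathfrak c}$ of functions $f_\alpha:\mathbb R\to\mathbb R$, with all operations pointwise, and let $\mathcal{AN}_{\mathfrak c}\subset(\mathbb R^{\mathbb R})^{\mathfrak c}$ be the family of those $(f_\alpha)_{\alpha<\mathfrak c}$ for which every $f_\alpha$ is Lebesgue measurable and there is a function $f:\mathbb R\to\mathbb R$ that is not Lebesgue measurable with $\lim_{\alpha<\mathfrak c}f_\alpha(x)=f(x)$ for $\lambda$-almost every $x$. (Here $\lim_{\alpha<\mathfrak c}y_\alpha=y$ means that for every neighbourhood $U$ of $y$ there is $\alpha_0<\mathfrak c$ with $y_\alpha\in U$ whenever $\alpha_0\le\alpha<\mathfrak c$.) A subset $A$ of a commutative algebra $E$ over a field $K$ is called strongly $\kappa$-algebrable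 if there is a (not necessarily unital) subalgebra $B\subseteq E$ with $B\setminus\{0\}\subseteq A$ that is a $\kappa$-generated free algebra, i.e. $B$ is generated by a set $X$ of cardinality $\kappa$ such that $P(x_1,\dots,x_n)\ne0$ for all $n\ge 1$, all distinct $x_1,\dots,x_n\in X$ and every nonzero polynomial $P$ in $n$ variables over $K$ without constant term. **Theorem.** If $\mathrm{non}(\mathcal N)=\mathfrak c$, then $\mathcal{AN}_{\mathfrak c}$ is strongly $2^{\mathfrak c}$-algebrable. -/

import Mathlib

open MeasureTheory Filter Topology Cardinal

noncomputable section

/-- The uniformity number of the Lebesgue null ideal: the least cardinality of a subset of `[0,1]`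
that is not Lebesgue null. (On arbitrary sets `volume` is Lebesgue outer measure, so
`volume X = 0` says exactly that `X` is Lebesgue null.) -/
def nonNull : Cardinal.{0} :=
  sInf {κ | ∃ X : Set ℝ, X ⊆ Set.Icc 0 1 ∧ volume X ≠ 0 ∧ #X = κ}

/-- The set underlying the initial ordinal of a cardinal `κ`, with its well-order; functions on it
are the `κ`-sequences. -/
abbrev SeqIndex (κ : Cardinal.{0}) : Type := κ.ord.ToType

/-- Nets `(f_a)_{a ∈ I}` of Lebesgue measurable functions `ℝ → ℝ` that converge almost everywhere
to some function `ℝ → ℝ` that is not Lebesgue measurable. Lebesgue measurability is measurability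
for the completion of the Borel σ-algebra under `volume`, that is, `NullMeasurable`. -/
def AN (I : Type) [Preorder I] : Set (I → ℝ → ℝ) :=
  {F | (∀ a, NullMeasurable (F a) volume) ∧
    ∃ f : ℝ → ℝ, ¬ NullMeasurable f volume ∧
      ∀ᵐ x ∂volume, Tendsto (fun a => F a x) atTop (𝓝 (f x))}

/-- `X` is algebraically independent in the sense of not necessarily unital commutative algebras:
no nonzero polynomial without constant term vanishes at distinct elements of `X`. -/
def AlgIndepNoConst (K : Type*) {E : Type*} [Field K] [CommRing E] [Algebra K E]
    (X : Set E) : Prop :=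
  ∀ P : MvPolynomial X K, MvPolynomial.constantCoeff P = 0 →
    MvPolynomial.aeval (fun x : X => (x : E)) P = 0 → P = 0

/-- The (not necessarily unital) subalgebra `B` of a commutative algebra is a `κ`-generated free
algebra: it is generated by an algebraically independent set of cardinality `κ`. -/
def IsFreeGenerated (K : Type*) {E : Type*} [Field K] [CommRing E] [Algebra K E]
    (κ : Cardinal) (B : NonUnitalSubalgebra K E) : Prop :=
  ∃ X : Set E, #X = κ ∧ NonUnitalAlgebra.adjoin K X = B ∧ AlgIndepNoConst K X

/-- `A` is strongly `κ`-algebrable: `A ∪ {0}` contains a `κ`-generated free algebra. -/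
def StronglyAlgebrable (K : Type*) {E : Type*} [Field K] [CommRing E] [Algebra K E]
    (κ : Cardinal) (A : Set E) : Prop :=
  ∃ B : NonUnitalSubalgebra K E, IsFreeGenerated K κ B ∧ (B : Set E) \ {0} ⊆ A

end

/-! If non(𝒩) = 𝔠, every set of fewer than 𝔠 reals is null. Enumerate ℝ in order type 𝔠: cutting any
f off to an initial segment leaves an a.e. zero function, and these truncations converge everywhere
to f. Truncation is multiplication by an indicator, so it commutes with polynomials without constant
term (`aeval_initialTruncation`). It therefore suffices to find 2^𝔠 functions in which every nonzero
such polynomial is nonmeasurable. Pull an independent family (`exists_independent_functions`) back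
along a map whose fibres all meet every Borel set of positive measure
(`exists_map_surjOn_positive_measure`): on each such set the polynomial takes both the value 0 and a
nonzero value. -/

/-- A family of at most `κ` sets, each of cardinality at least `κ`, has an injective choice
function. -/
theorem exists_injective_transversal {ι α : Type} {κ : Cardinal.{0}} (hι : #ι ≤ κ)
    (A : ι → Set α) (hA : ∀ i, κ ≤ #(A i)) :
    ∃ f : ι → α, Function.Injective f ∧ ∀ i, f i ∈ A i := by
  classical
  -- In a well-order of least type, fewer than `#ι` indices precede `i`, so earlier choices cannot
  -- exhaust `A i`.
  obtain ⟨r, wo, hr⟩ := Cardinal.exists_ord_eq ι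
  have key : ∀ (i : ι) (g : ∀ j, r j i → α), ∃ x ∈ A i, ∀ j (hj : r j i), g j hj ≠ x := by
    intro i g
    by_contra! hcon
    have hsub : A i ⊆ Set.range (fun j : {j // r j i} => g j.1 j.2) := by
      intro x hx
      obtain ⟨j, hj, hx'⟩ := hcon x hx
      exact ⟨⟨j, hj⟩, hx'⟩
    have h₁ : #(A i) ≤ #{j // r j i} := (mk_le_mk_of_subset hsub).trans mk_range_le
    have h₂ : #{j // r j i} < #ι := by
      have := card_typein_lt i hr
      rwa [Ordinal.card_typein] at this
    exact absurd (h₁.trans_lt (h₂.trans_le hι)) (hA i).not_gt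
  choose F hFA hF using key
  let f : ι → α := wo.wf.fix F
  have hf : ∀ i, f i = F i (fun j _ => f j) := fun i => wo.wf.fix_eq F i
  have hne : ∀ i j, r j i → f j ≠ f i := by
    intro i j hj
    rw [hf i]
    exact hF i (fun j _ => f j) j hj
  refine ⟨f, fun i j hij => ?_, fun i => ?_⟩
  · rcases trichotomous_of r i j with h | h | h
    · exact absurd hij (hne j i h)
    · exact h
    · exact absurd hij.symm (hne i j h)
  · rw [hf i]
    exact hFA i _

/-- Every set of reals of cardinality less than `nonNull` is Lebesgue null. -/
theorem volume_eq_zero_of_mk_lt_nonNull {X : Set ℝ} (hX : #X < nonNull) : volume X = 0 := by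
  have hpiece : ∀ n : ℤ, volume (X ∩ Set.Icc (n : ℝ) (n + 1)) = 0 := by
    intro n
    by_contra hne
    have himg : volume ((fun x : ℝ => -(n : ℝ) + x) '' (X ∩ Set.Icc (n : ℝ) (n + 1))) ≠ 0 := by
      rwa [Set.image_add_left, measure_preimage_add]
    have hle : nonNull ≤ #((fun x : ℝ => -(n : ℝ) + x) '' (X ∩ Set.Icc (n : ℝ) (n + 1))) := by
      refine csInf_le' ⟨_, ?_, himg, rfl⟩
      rintro _ ⟨x, ⟨-, hx₁, hx₂⟩, rfl⟩
      constructor <;> dsimp only <;> linarith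
    exact absurd (hle.trans (mk_image_le.trans (mk_le_mk_of_subset Set.inter_subset_left)))
      hX.not_ge
  refine measure_mono_null (fun x hx => ?_) (measure_iUnion_null hpiece)
  exact Set.mem_iUnion.2 ⟨⌊x⌋, hx, Int.floor_le x, (Int.lt_floor_add_one x).le⟩

/-- There are continuum many Borel sets of reals. -/
theorem mk_measurableSet_real_le : #{s : Set ℝ // MeasurableSet s} ≤ continuum.{0} := by
  obtain ⟨b, hb, h⟩ := MeasurableSpace.CountablyGenerated.isCountablyGenerated (α := ℝ)
  rw [h]
  exact MeasurableSpace.cardinal_measurableSet_le_continuum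
    (hb.le_aleph0.trans aleph0_le_continuum)

/-- If `non(𝒩) = 𝔠`, the line can be partitioned into any `κ ≤ 𝔠` many sets of full outer
measure. -/
theorem exists_map_surjOn_positive_measure (h : nonNull = continuum.{0}) {T : Type} [Nonempty T]
    (hT : #T ≤ continuum.{0}) :
    ∃ τ : ℝ → T, ∀ C : Set ℝ, MeasurableSet C → volume C ≠ 0 → ∀ t, ∃ x ∈ C, τ x = t := by
  -- As in Bernstein's construction, each pair (C, t) receives its own point of C, which `τ` sends
  -- to t.
  let ι := {C : {s : Set ℝ // MeasurableSet s} // volume C.1 ≠ 0} × T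
  have hι : #ι ≤ continuum.{0} := by
    rw [mk_prod, lift_id, lift_id, ← continuum_mul_self]
    exact mul_le_mul' ((mk_subtype_le _).trans mk_measurableSet_real_le) hT
  obtain ⟨p, hp, hpC⟩ := exists_injective_transversal hι (fun i => i.1.1.1) fun i => by
    by_contra! hlt
    exact i.1.2 (volume_eq_zero_of_mk_lt_nonNull (h ▸ hlt))
  refine ⟨Function.extend p Prod.snd fun _ => Classical.arbitrary T, fun C hC hC0 t => ?_⟩
  exact ⟨p (⟨⟨C, hC⟩, hC0⟩, t), hpC (⟨⟨C, hC⟩, hC0⟩, t), hp.extend_apply _ _ _⟩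

/-- A finite family of sets is separated by the traces on a finite set. -/
theorem exists_finset_injOn_filter {α : Type} (S : Finset (Set α)) :
    ∃ F : Finset α, ∀ A ∈ S, ∀ B ∈ S, (∀ x ∈ F, x ∈ A ↔ x ∈ B) → A = B := by
  classical
  have hsep : ∀ A B : Set α, ∃ F : Finset α, (∀ x ∈ F, x ∈ A ↔ x ∈ B) → A = B := by
    intro A B
    by_cases hAB : A = B
    · exact ⟨∅, fun _ => hAB⟩
    · obtain ⟨x, hx⟩ : ∃ x, ¬ (x ∈ A ↔ x ∈ B) := by
        by_contra! hcon
        exact hAB (Set.ext hcon)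
      exact ⟨{x}, fun hF => absurd (hF x (Finset.mem_singleton_self x)) hx⟩
  choose F hF using hsep
  refine ⟨(S ×ˢ S).biUnion fun p => F p.1 p.2, fun A hA B hB hAB => hF A B fun x hx => ?_⟩
  exact hAB x (Finset.mem_biUnion.2 ⟨(A, B), Finset.mem_product.2 ⟨hA, hB⟩, hx⟩)

/-- There are `2 ^ 𝔠` real functions on a set of size at most `𝔠` any finitely many of which take
arbitrarily prescribed values simultaneously. -/
theorem exists_independent_functions :
    ∃ T : Type, #T ≤ continuum.{0} ∧ ∃ g : Set ℝ → T → ℝ,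
      ∀ (S : Finset (Set ℝ)) (y : Set ℝ → ℝ), ∃ t, ∀ A ∈ S, g A t = y A := by
  classical
  -- Hausdorff's independent family with real values: `g A (F, φ) = φ (F ∩ A)`. Once F separates the
  -- sets in `S`, their traces are distinct and φ can be prescribed on them.
  refine ⟨Finset ℝ × (Finset ℝ →₀ ℝ), ?_, fun A t => t.2 (t.1.filter (· ∈ A)), fun S y => ?_⟩
  · simp [mk_real]
  · obtain ⟨F, hF⟩ := exists_finset_injOn_filter S
    refine ⟨(F, ∑ A ∈ S, Finsupp.single (F.filter (· ∈ A)) (y A)), fun B hB => ?_⟩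
    dsimp only
    rw [Finsupp.finsetSum_apply, Finset.sum_eq_single_of_mem B hB, Finsupp.single_eq_same]
    intro A hA hAB
    refine Finsupp.single_eq_of_ne fun heq => hAB (hF A hA B hB fun x hx => ?_)
    have := congrArg (x ∈ ·) heq.symm
    simpa [hx] using this

/-- A function whose zeros and nonzeros both meet every Borel set of positive measure is not
Lebesgue measurable. -/
theorem not_nullMeasurable_of_zeros_dense {f : ℝ → ℝ}
    (h₀ : ∀ C : Set ℝ, MeasurableSet C → volume C ≠ 0 → ∃ x ∈ C, f x = 0)
    (h₁ : ∀ C : Set ℝ, MeasurableSet C → volume C ≠ 0 → ∃ x ∈ C, f x ≠ 0) :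
    ¬ NullMeasurable f volume := by
  intro hf
  have hZ : NullMeasurableSet (f ⁻¹' {0}) volume := hf (measurableSet_singleton 0)
  have hnull : ∀ s : Set ℝ, NullMeasurableSet s volume →
      (∀ C ⊆ s, MeasurableSet C → volume C = 0) → volume s = 0 := by
    intro s hs hC
    obtain ⟨t, hts, ht, hae⟩ := hs.exists_measurable_subset_ae_eq
    rw [← measure_congr hae, hC t hts ht]
  have hz : volume (f ⁻¹' {0}) = 0 := by
    refine hnull _ hZ fun C hCs hC => ?_
    by_contra hC0
    obtain ⟨x, hx, hfx⟩ := h₁ C hC hC0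
    exact hfx (hCs hx)
  have hzc : volume (f ⁻¹' {0})ᶜ = 0 := by
    refine hnull _ hZ.compl fun C hCs hC => ?_
    by_contra hC0
    obtain ⟨x, hx, hfx⟩ := h₀ C hC hC0
    exact hCs hx hfx
  have huniv := measure_union_null hz hzc
  rw [Set.union_compl_self, Real.volume_univ] at huniv
  exact ENNReal.top_ne_zero huniv

/-- The net of truncations of `f` to initial segments along an enumeration `e` of the line. -/
noncomputable def initialTruncation {I : Type} [LinearOrder I] (e : ℝ ≃ I) (f : ℝ → ℝ) :
    I → ℝ → ℝ :=
  fun a x => if e x < a then f x else 0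

/-- The truncations of `f` converge pointwise to `f`. -/
theorem tendsto_initialTruncation {I : Type} [LinearOrder I] [NoMaxOrder I] (e : ℝ ≃ I)
    (f : ℝ → ℝ) (x : ℝ) :
    Tendsto (fun a => initialTruncation e f a x) atTop (𝓝 (f x)) := by
  refine tendsto_const_nhds.congr' ?_
  filter_upwards [eventually_gt_atTop (e x)] with a ha
  rw [initialTruncation, if_pos ha]

/-- If `non(𝒩) = 𝔠`, the truncations of a nonmeasurable function form a net of measurable
functions converging to a nonmeasurable one. -/
theorem initialTruncation_mem_AN (h : nonNull = continuum.{0})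
    (e : ℝ ≃ SeqIndex continuum.{0}) {f : ℝ → ℝ} (hf : ¬ NullMeasurable f volume) :
    initialTruncation e f ∈ AN (SeqIndex continuum.{0}) := by
  have := Cardinal.noMaxOrder aleph0_le_continuum.{0}
  refine ⟨fun a => ?_, f, hf, Eventually.of_forall fun x => tendsto_initialTruncation e f x⟩
  -- Proper initial segments of the initial ordinal of 𝔠 have fewer than 𝔠 elements.
  have hnull : volume (e ⁻¹' Set.Iio a) = 0 := by
    refine volume_eq_zero_of_mk_lt_nonNull ?_
    rw [h, mk_preimage_equiv]
    simpa using mk_Iio_lt a (by simp)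
  have hae : initialTruncation e f a =ᵐ[volume] fun _ => (0 : ℝ) := by
    filter_upwards [measure_eq_zero_iff_ae_notMem.1 hnull] with x hx
    exact if_neg hx
  exact (aemeasurable_const.congr hae.symm).nullMeasurable

/-- Every element of the non-unital algebra generated by `X` is the value at `X` of a polynomial
without constant term. -/
theorem exists_aeval_eq_of_mem_adjoin {K E : Type*} [Field K] [CommRing E] [Algebra K E]
    {X : Set E} {b : E} (hb : b ∈ NonUnitalAlgebra.adjoin K X) :
    ∃ P : MvPolynomial X K, MvPolynomial.constantCoeff P = 0 ∧
      MvPolynomial.aeval (fun x : X => (x : E)) P = b := by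
  induction hb using NonUnitalAlgebra.adjoin_induction with
  | mem x hx => exact ⟨MvPolynomial.X ⟨x, hx⟩, by simp, by simp⟩
  | add x y _ _ hx hy =>
    obtain ⟨P, hP, rfl⟩ := hx
    obtain ⟨Q, hQ, rfl⟩ := hy
    exact ⟨P + Q, by simp [hP, hQ], by simp⟩
  | zero => exact ⟨0, by simp, by simp⟩
  | mul x y _ _ hx hy =>
    obtain ⟨P, hP, rfl⟩ := hx
    obtain ⟨Q, hQ, rfl⟩ := hy
    exact ⟨P * Q, by simp [hP], by simp⟩
  | smul r x _ hx =>
    obtain ⟨P, hP, rfl⟩ := hx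
    exact ⟨r • P, by simp [hP, MvPolynomial.smul_eq_C_mul], by simp⟩

/-- A polynomial without constant term commutes with truncation. -/
theorem aeval_initialTruncation {I σ : Type} [LinearOrder I] (e : ℝ ≃ I) (v : σ → ℝ → ℝ)
    {P : MvPolynomial σ ℝ} (hP : MvPolynomial.constantCoeff P = 0) :
    MvPolynomial.aeval (fun i => initialTruncation e (v i)) P =
      initialTruncation e fun x => MvPolynomial.eval (fun i => v i x) P := by
  funext a x
  have hev := MvPolynomial.comp_aeval_apply (fun i => initialTruncation e (v i))
    ((Pi.evalAlgHom ℝ (fun _ : ℝ => ℝ) x).comp (Pi.evalAlgHom ℝ (fun _ : I => ℝ → ℝ) a)) P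
  refine hev.trans ?_
  rw [MvPolynomial.aeval_eq_eval]
  by_cases hx : e x < a
  · simp [initialTruncation, hx]
  -- Beyond the cut every variable is 0, so the polynomial reduces to its constant term.
  · have hz : (fun i => ((Pi.evalAlgHom ℝ (fun _ : ℝ => ℝ) x).comp
        (Pi.evalAlgHom ℝ (fun _ : I => ℝ → ℝ) a)) (initialTruncation e (v i))) =
        (0 : σ → ℝ) := by
      funext i
      simp [initialTruncation, hx]
    simp only [hz, initialTruncation, if_neg hx]
    simpa [MvPolynomial.constantCoeff_eq, MvPolynomial.eval_zero] using hP

/-- A nonzero polynomial without constant term in independent functions, spread over the line so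
that each fibre has full outer measure, is not Lebesgue measurable. -/
theorem not_nullMeasurable_eval {T σ : Type} {τ : ℝ → T} {g : σ → T → ℝ}
    (hτ : ∀ C : Set ℝ, MeasurableSet C → volume C ≠ 0 → ∀ t, ∃ x ∈ C, τ x = t)
    (hg : ∀ (S : Finset σ) (y : σ → ℝ), ∃ t, ∀ i ∈ S, g i t = y i)
    {P : MvPolynomial σ ℝ} (hP : MvPolynomial.constantCoeff P = 0) (hP0 : P ≠ 0) :
    ¬ NullMeasurable (fun x => MvPolynomial.eval (fun i => g i (τ x)) P) volume := by
  have hval : ∀ y : σ → ℝ, ∃ t, MvPolynomial.eval (fun i => g i t) P = MvPolynomial.eval y P := by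
    intro y
    obtain ⟨t, ht⟩ := hg P.vars y
    exact ⟨t, MvPolynomial.eval₂Hom_congr' rfl (fun i hi _ => ht i hi) rfl⟩
  refine not_nullMeasurable_of_zeros_dense (fun C hC hC0 => ?_) fun C hC hC0 => ?_
  · obtain ⟨t, ht⟩ := hval 0
    obtain ⟨x, hx, rfl⟩ := hτ C hC hC0 t
    exact ⟨x, hx, ht.trans (by simpa [MvPolynomial.eval_zero] using hP)⟩
  · obtain ⟨y, hy⟩ : ∃ y, MvPolynomial.eval y P ≠ 0 := by
      by_contra! hcon
      exact hP0 (MvPolynomial.funext fun y => by simpa using hcon y)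
    obtain ⟨t, ht⟩ := hval y
    obtain ⟨x, hx, rfl⟩ := hτ C hC hC0 t
    exact ⟨x, hx, fun h0 => hy (ht.symm.trans h0)⟩

theorem mainTheorem9 (h : nonNull = continuum.{0}) :
    StronglyAlgebrable ℝ ((2 : Cardinal.{0}) ^ continuum.{0}) (AN (SeqIndex continuum.{0})) := by
  classical
  have := Cardinal.noMaxOrder aleph0_le_continuum.{0}
  obtain ⟨e⟩ : Nonempty (ℝ ≃ SeqIndex continuum.{0}) := by
    rw [← Cardinal.eq, mk_real, mk_ord_toType]
  have : Nonempty (SeqIndex continuum.{0}) := ⟨e 0⟩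
  obtain ⟨T, hT, g, hg⟩ := exists_independent_functions
  have : Nonempty T := ⟨(hg ∅ 0).choose⟩
  obtain ⟨τ, hτ⟩ := exists_map_surjOn_positive_measure h hT
  let G : Set ℝ → SeqIndex continuum.{0} → ℝ → ℝ :=
    fun A => initialTruncation e fun x => g A (τ x)
  have hG : Function.Injective G := by
    intro A B hAB
    by_contra hne
    obtain ⟨t, ht⟩ := hg {A, B} fun C => if C = A then 1 else 0
    have htA : g A t = 1 := by simpa using ht A (by simp)
    have htB : g B t = 0 := by simpa [Ne.symm hne] using ht B (by simp)
    obtain ⟨x, -, rfl⟩ := hτ Set.univ MeasurableSet.univ (by simp) t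
    have hlim := tendsto_nhds_unique (tendsto_initialTruncation e (fun x => g A (τ x)) x)
      ((tendsto_initialTruncation e (fun x => g B (τ x)) x).congr fun a =>
        congrFun (congrFun hAB.symm a) x)
    simp only [htA, htB, one_ne_zero] at hlim
  -- The generators are indexed by `Set.range G`; `A` recovers their labels, so independence
  -- transfers to this index.
  choose A hA using fun i : Set.range G => i.2
  have hAinj : Function.Injective A := fun i j hij => Subtype.ext (by rw [← hA i, ← hA j, hij])
  have hgA : ∀ (S : Finset (Set.range G)) (y : Set.range G → ℝ), ∃ t, ∀ i ∈ S,
      g (A i) t = y i := by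
    intro S y
    obtain ⟨t, ht⟩ := hg (S.image A) (Function.extend A y 0)
    exact ⟨t, fun i hi => (ht _ (Finset.mem_image_of_mem A hi)).trans (hAinj.extend_apply y 0 i)⟩
  have haeval : ∀ P : MvPolynomial (Set.range G) ℝ, MvPolynomial.constantCoeff P = 0 →
      MvPolynomial.aeval (fun i : Set.range G => (i : SeqIndex continuum.{0} → ℝ → ℝ)) P =
        initialTruncation e fun x => MvPolynomial.eval (fun i => g (A i) (τ x)) P := by
    intro P hP
    rw [← aeval_initialTruncation e (fun i x => g (A i) (τ x)) hP]
    congr 2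
    funext i
    exact (hA i).symm
  refine ⟨NonUnitalAlgebra.adjoin ℝ (Set.range G), ⟨Set.range G, ?_, rfl, ?_⟩, ?_⟩
  · rw [mk_range_eq G hG, mk_set, mk_real]
  · intro P hP hP0
    by_contra hne
    rw [haeval P hP] at hP0
    refine not_nullMeasurable_eval hτ hgA hP hne ?_
    -- A vanishing net has limit 0, which is measurable.
    have hzero : (fun x => MvPolynomial.eval (fun i => g (A i) (τ x)) P) = fun _ => 0 := by
      funext x
      have hlim := tendsto_initialTruncation e
        (fun x => MvPolynomial.eval (fun i => g (A i) (τ x)) P) x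
      rw [hP0] at hlim
      exact tendsto_nhds_unique hlim tendsto_const_nhds
    rw [hzero]
    exact measurable_const.nullMeasurable
  · rintro b ⟨hb, hb0⟩
    obtain ⟨P, hP, rfl⟩ := exists_aeval_eq_of_mem_adjoin hb
    have hne : P ≠ 0 := by
      rintro rfl
      exact hb0 (map_zero _)
    rw [haeval P hP]
    exact initialTruncation_mem_AN h e (not_nullMeasurable_eval hτ hgA hP hne)
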